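/- Let $F$ be a field, $Q$ a quiver with finite vertex set $Q_0$, $W$ a finite-dimensional representation of $Q$ over $F$, and $\sigma:Q_0\to\mathbb Z$ a weight; put $\sigma_+(x)=\max\{0,\sigma(x)\}$ and $\sigma_-(x)=-\min\{0,\sigma(x)\}$. (Directed cycles in $Q$ are allowed.) Let $\mathcal A$ be the space of all linear maps $$\bigoplus_{x\in Q_0} W(x)^{\sigma_+(x)}\longrightarrow\bigoplus_{x\in Q_0} W(x)^{\sigma_-(x)}$$ in which each block from a copy of $W(x)$ to a copy of $W(y)$ is a linear combination of the maps $W(p)$, $p$ a path from $x$ to $y$. For a space $\mathcal B$ of linear maps $V\to V'$ between finite-dimensional spaces and $e\ge 1$, let $\mathcal B^{\{e\}}=M(e,F)\otimes\mathcal B$ be its $e$-th blow-up (the $e\times e$ block matrices $V^e\to V'^e$ with all blocks in $\mathcal B$), let $\operatorname{rk}\mathcal B$ be the largest rank of an element of $\mathcal B$, and let $\operatorname{ncrk}\mathcal B=\sup_{e\ge1}\operatorname{rk}(\mathcal B^{\{e\}})/e$ be its non-commutative rank. A subspace $U\subseteq V$ is $k$-shrunk for $\mathcal B$ if there is a subspace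 $Z\subseteq V'$ with $\dim Z\le\dim U-k$ and $T(U)\subseteq Z$ for all $T\in\mathcal B$. The image of $U$ under $\mathcal B$ is $\sum_{T\in\mathcal B}T(U)$. Put $c=\sum_x\sigma_+(x)\dim W(x)-\operatorname{ncrk}\mathcal A$. Let $d\ge1$ and let $A\in\mathcal A^{\{d\}}$ be a matrix with $\operatorname{rk}A=\operatorname{ncrk}\mathcal A^{\{d\}}$, the largest rank possible. Let $B:\bigoplus_x W(x)^{d\sigma_-(x)}\to\bigoplus_x W(x)^{d\sigma_+(x)}$ be a pseudo-inverse of $A$: a linear map such that, for some direct complement $C$ of $\ker A$, the restriction of $B$ to $\operatorname{Im}A$ is the inverse of $A|_C:C\to\operatorname{Im}A$. Let $W^+$ be the representation obtained from $W$ by adding, for every copy of $W(y)$ in $\bigoplus_x W(x)^{d\sigma_-(x)}$ and every copy of $W(x)$ in $\bigoplus_x W(x)^{d\sigma_+(x)}$, an arrow $y\to x$ on which $W^+$ is the corresponding block $W(y)\to W(x)$ of $B$. Let $K(x)\subseteq W(x)$ be the sum of the projections of $\ker A$ to the $d\sigma_+(x)$ copies of $W(x)$ (so $K(x)=0$ if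 $\sigma(x)\le0$), and let $W'$ be the smallest subrepresentation of $W^+$ with $K(x)\subseteq W'(x)$ for all $x$; it is also a subrepresentation of $W$. Then: 1. $c$ is the largest number $k$ for which $\mathcal A$ has a $k$-shrunk subspace, and $cd$ is the largest number $k$ for which $\mathcal A^{\{d\}}$ has a $k$-shrunk subspace; 2. $\bigoplus_x W'(x)^{d\sigma_+(x)}$ is the minimal $cd$-shrunk subspace of $\mathcal A^{\{d\}}$: it is $cd$-shrunk and is contained in every $cd$-shrunk subspace of $\mathcal A^{\{d\}}$; 3. the image of $\bigoplus_x W'(x)^{d\sigma_+(x)}$ under $\mathcal A^{\{d\}}$ is $\bigoplus_x W'(x)^{d\sigma_-(x)}$; 4. $W'$ is an optimal $\sigma$-witness of $W$: writing $\sigma(\underline{\dim}\,S)=\sum_x\sigma(x)\dim S(x)$, one has $\sigma(\underline{\dim}\,S)\le\sigma(\underline{\dim}\,W')$ for every subrepresentation $S$ of $W$; moreover $\sigma(\underline{\dim}\,W')=c$. -/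

import Mathlib

noncomputable section

open Module

/-! ### Matrix spaces, blow-ups, non-commutative rank, shrunk subspaces

A matrix space is a linear subspace `𝒜` of `V →ₗ[F] V'`. -/

section MatrixSpaces

variable {F : Type*} [Field F]
variable {V : Type*} [AddCommGroup V] [Module F V]
variable {V' : Type*} [AddCommGroup V'] [Module F V']

/-- The largest rank of an element of the matrix space `𝒜`
(for `V` or `V'` finite-dimensional, so that the set of ranks is bounded). -/
def matrixSpaceRank (𝒜 : Submodule F (V →ₗ[F] V')) : ℕ :=
  sSup {r : ℕ | ∃ T ∈ 𝒜, finrank F (LinearMap.range T) = r}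

/-- The `d`-th tensor blow-up `M(d, F) ⊗ 𝒜`: the `d × d` block matrices `V ^ d → V' ^ d`
all of whose blocks belong to `𝒜`. -/
def blowup (𝒜 : Submodule F (V →ₗ[F] V')) (d : ℕ) :
    Submodule F ((Fin d → V) →ₗ[F] (Fin d → V')) where
  carrier := {T | ∀ i j : Fin d,
    LinearMap.proj i ∘ₗ T ∘ₗ LinearMap.single F (fun _ : Fin d => V) j ∈ 𝒜}
  zero_mem' := fun i j => by simp
  add_mem' := fun {S T} hS hT i j => by
    have := 𝒜.add_mem (hS i j) (hT i j)
    simpa [LinearMap.add_comp, LinearMap.comp_add] using this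
  smul_mem' := fun a T hT i j => by
    have := 𝒜.smul_mem a (hT i j)
    simpa [LinearMap.smul_comp, LinearMap.comp_smul] using this

/-- The non-commutative rank of a matrix space: the supremum over `e ≥ 1` of
`rk (𝒜^{e}) / e`, where `𝒜^{e}` is the `e`-th blow-up. -/
def ncrk (𝒜 : Submodule F (V →ₗ[F] V')) : ℝ :=
  ⨆ e : ℕ+, (matrixSpaceRank (blowup 𝒜 (e : ℕ)) : ℝ) / ((e : ℕ) : ℝ)

/-- The number `c = n - ncrk 𝒜`, where `n` is the dimension of the source space. -/
def shrinkNumber (𝒜 : Submodule F (V →ₗ[F] V')) : ℝ :=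
  (finrank F V : ℝ) - ncrk 𝒜

/-- `U` is a `c`-shrunk subspace of `𝒜`: there is a subspace `Z` with `dim Z ≤ dim U - c`
and `T U ⊆ Z` for all `T` in `𝒜`. -/
def IsShrunk (𝒜 : Submodule F (V →ₗ[F] V')) (c : ℝ) (U : Submodule F V) : Prop :=
  ∃ Z : Submodule F V', (finrank F Z : ℝ) ≤ (finrank F U : ℝ) - c ∧
    ∀ T ∈ 𝒜, U.map T ≤ Z

/-- The image `𝒜(U)`, i.e. the sum of the subspaces `T U` over all `T` in `𝒜`. -/
def spaceImage (𝒜 : Submodule F (V →ₗ[F] V')) (U : Submodule F V) : Submodule F V' :=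
  ⨆ T ∈ 𝒜, U.map T

/-- `B` is a pseudo-inverse of `A`: the restriction of `B` to the image of `A` is the inverse
of the restriction of `A` to some direct complement of `ker A`. -/
def IsPseudoInverse (A : V →ₗ[F] V') (B : V' →ₗ[F] V) : Prop :=
  ∃ C : Submodule F V, IsCompl (LinearMap.ker A) C ∧ ∀ v ∈ C, B (A v) = v

end MatrixSpaces

/-! ### Representations of quivers and subrepresentations -/

/-- A finite-dimensional representation over `F` of the quiver `Q`. -/
structure QuiverRep (F : Type*) [Field F] (Q : Type*) [Quiver Q] where
  /-- the space at a vertex -/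
  obj : Q → Type*
  [addCommGroup : ∀ x, AddCommGroup (obj x)]
  [module : ∀ x, Module F (obj x)]
  [finite : ∀ x, Module.Finite F (obj x)]
  /-- the linear map attached to an arrow -/
  map : ∀ {x y : Q}, (x ⟶ y) → (obj x →ₗ[F] obj y)

attribute [instance] QuiverRep.addCommGroup QuiverRep.module QuiverRep.finite

namespace QuiverRep

variable {F : Type*} [Field F] {Q : Type*} [Quiver Q]

/-- The linear map `W(p)` attached to a path `p` (the identity for the empty path). -/
def pathMap (W : QuiverRep F Q) {x : Q} :
    ∀ {y : Q}, Quiver.Path x y → (W.obj x →ₗ[F] W.obj y)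
  | _, Quiver.Path.nil => LinearMap.id
  | _, Quiver.Path.cons p a => W.map a ∘ₗ W.pathMap p

/-- A subrepresentation of `W`: a subspace at each vertex, stable under all arrows. -/
structure Subrep (W : QuiverRep F Q) where
  /-- the subspace at a vertex -/
  space : ∀ x, Submodule F (W.obj x)
  stable : ∀ {x y : Q} (a : x ⟶ y), (space x).map (W.map a) ≤ space y

/-- The smallest subrepresentation of `W` containing the subspaces `K x`: the intersection of
all subrepresentations that contain them. -/
def generatedSubrep (W : QuiverRep F Q) (K : ∀ x, Submodule F (W.obj x)) : W.Subrep where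
  space x := ⨅ S : {S : W.Subrep // ∀ z, K z ≤ S.space z}, S.1.space x
  stable {x y} a := by
    refine le_iInf fun S => ?_
    exact (Submodule.map_mono (iInf_le _ S)).trans (S.1.stable a)

theorem le_generatedSubrep (W : QuiverRep F Q) (K : ∀ x, Submodule F (W.obj x)) (x : Q) :
    K x ≤ (W.generatedSubrep K).space x :=
  le_iInf fun S => S.2 x

theorem generatedSubrep_le (W : QuiverRep F Q) (K : ∀ x, Submodule F (W.obj x))
    (S : W.Subrep) (hS : ∀ z, K z ≤ S.space z) (x : Q) :
    (W.generatedSubrep K).space x ≤ S.space x :=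
  iInf_le (fun S : {S : W.Subrep // ∀ z, K z ≤ S.space z} => S.1.space x) ⟨S, hS⟩

/-- The weight `σ(dim S) = ∑ₓ σ(x) dim S(x)` of a subrepresentation. -/
def Subrep.weight [Fintype Q] {W : QuiverRep F Q} (S : W.Subrep) (σ : Q → ℤ) : ℤ :=
  ∑ x, σ x * (finrank F (S.space x) : ℤ)

/-- An optimal `σ`-witness: a subrepresentation of `W` of the largest possible weight. -/
def Subrep.IsOptimalWitness [Fintype Q] {W : QuiverRep F Q} (S : W.Subrep) (σ : Q → ℤ) :
    Prop :=
  ∀ S' : W.Subrep, S'.weight σ ≤ S.weight σ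

end QuiverRep

/-! ### The matrix space of a weight -/

/-- `σ₊(x) = max(0, σ(x))`. -/
def weightPos {Q : Type*} (σ : Q → ℤ) (x : Q) : ℕ := (σ x).toNat

/-- `σ₋(x) = -min(0, σ(x))`. -/
def weightNeg {Q : Type*} (σ : Q → ℤ) (x : Q) : ℕ := (-σ x).toNat

namespace QuiverRep

variable {F : Type*} [Field F] {Q : Type*} [Quiver Q]

/-- The space `⨁ₓ W(x) ^ m(x)`; the index `⟨x, k⟩` stands for the `k`-th copy of `W(x)`. -/
abbrev Copies (W : QuiverRep F Q) (m : Q → ℕ) : Type _ :=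
  (s : Σ x : Q, Fin (m x)) → W.obj s.1

/-- The matrix space of `W` and `σ`: all block matrices
`⨁ₓ W(x) ^ σ₊(x) → ⨁ₓ W(x) ^ σ₋(x)` in which every block from a copy of `W(x)` to a copy of
`W(y)` is a linear combination of the maps `W(p)`, for `p` a path from `x` to `y`. -/
def weightSpace [DecidableEq Q] (W : QuiverRep F Q) (σ : Q → ℤ) :
    Submodule F (W.Copies (weightPos σ) →ₗ[F] W.Copies (weightNeg σ)) where
  carrier := {T | ∀ (s : Σ x : Q, Fin (weightPos σ x)) (t : Σ y : Q, Fin (weightNeg σ y)),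
    LinearMap.proj t ∘ₗ T ∘ₗ
        LinearMap.single F (fun s : Σ x : Q, Fin (weightPos σ x) => W.obj s.1) s ∈
      Submodule.span F (Set.range fun p : Quiver.Path s.1 t.1 => W.pathMap p)}
  zero_mem' := fun s t => by simp
  add_mem' := fun {S T} hS hT s t => by
    have := Submodule.add_mem _ (hS s t) (hT s t)
    simpa [LinearMap.add_comp, LinearMap.comp_add] using this
  smul_mem' := fun a T hT s t => by
    have := Submodule.smul_mem _ a (hT s t)
    simpa [LinearMap.smul_comp, LinearMap.comp_smul] using this

/-- The `d`-fold space `⨁ₓ W(x) ^ (d m(x))`; its copies of `W(x)` are indexed by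
`Fin d × Fin (m x)`. -/
abbrev BlowupCopies (W : QuiverRep F Q) (m : Q → ℕ) (d : ℕ) : Type _ :=
  Fin d → W.Copies m

/-- The projection of `⨁ₓ W(x) ^ (d m(x))` to the `i`-th copy of `W(x)`. -/
def copyProj (W : QuiverRep F Q) (m : Q → ℕ) (d : ℕ) (x : Q) (i : Fin d × Fin (m x)) :
    W.BlowupCopies m d →ₗ[F] W.obj x :=
  (LinearMap.proj (⟨x, i.2⟩ : Σ x : Q, Fin (m x)) : W.Copies m →ₗ[F] W.obj x) ∘ₗ
    (LinearMap.proj i.1 : W.BlowupCopies m d →ₗ[F] W.Copies m)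

/-- The inclusion of the `i`-th copy of `W(x)` in `⨁ₓ W(x) ^ (d m(x))`. -/
def copyIncl [DecidableEq Q] (W : QuiverRep F Q) (m : Q → ℕ) (d : ℕ) (x : Q)
    (i : Fin d × Fin (m x)) : W.obj x →ₗ[F] W.BlowupCopies m d :=
  LinearMap.single F (fun _ : Fin d => W.Copies m) i.1 ∘ₗ
    LinearMap.single F (fun s : Σ x : Q, Fin (m x) => W.obj s.1) ⟨x, i.2⟩

/-- The subspace `⨁ₓ S(x) ^ (d m(x))` of `⨁ₓ W(x) ^ (d m(x))`. -/
def blowupSubspace (W : QuiverRep F Q) (S : ∀ x, Submodule F (W.obj x)) (m : Q → ℕ) (d : ℕ) :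
    Submodule F (W.BlowupCopies m d) where
  carrier := {v | ∀ (i : Fin d) (s : Σ x : Q, Fin (m x)), v i s ∈ S s.1}
  zero_mem' := fun _ s => (S s.1).zero_mem
  add_mem' := fun hv hw i s => (S s.1).add_mem (hv i s) (hw i s)
  smul_mem' := fun a _ hv i s => (S s.1).smul_mem a (hv i s)

end QuiverRep

/-! ### The augmented quiver and representation -/

/-- The vertices of the augmented quiver `Q⁺`: those of `Q`. -/
def AugQuiver (Q : Type*) (_σ : Q → ℤ) (_d : ℕ) : Type _ := Q

/-- The arrows `y ⟶ x` of `Q⁺`: those of `Q`, and one new arrow for each pair of a copy of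
`W(y)` in `⨁ W(y) ^ (d σ₋(y))` and a copy of `W(x)` in `⨁ W(x) ^ (d σ₊(x))`. -/
instance AugQuiver.quiver {Q : Type*} [Quiver Q] (σ : Q → ℤ) (d : ℕ) :
    Quiver (AugQuiver Q σ d) where
  Hom y x := (Quiver.Hom (V := Q) y x) ⊕
    ((Fin d × Fin (weightNeg (Q := Q) σ y)) × (Fin d × Fin (weightPos (Q := Q) σ x)))

namespace QuiverRep

variable {F : Type*} [Field F] {Q : Type*} [Quiver Q]

/-- The maps of the augmented representation: an arrow of `Q` acts as in `W`, and the new arrow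
of the pair `(j, i)` acts as the block of `B` from the `j`-th copy of `W(y)` to the `i`-th copy
of `W(x)`. -/
def augmentMap [DecidableEq Q] (W : QuiverRep F Q) (σ : Q → ℤ) (d : ℕ)
    (B : W.BlowupCopies (weightNeg σ) d →ₗ[F] W.BlowupCopies (weightPos σ) d) {y x : Q} :
    (y ⟶ x) ⊕ ((Fin d × Fin (weightNeg σ y)) × (Fin d × Fin (weightPos σ x))) →
      (W.obj y →ₗ[F] W.obj x)
  | Sum.inl a => W.map a
  | Sum.inr (j, i) =>
      W.copyProj (weightPos σ) d x i ∘ₗ B ∘ₗ W.copyIncl (weightNeg σ) d y j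

/-- The augmented representation `W⁺` of `Q⁺`: the spaces and the arrows of `W`, and for each
new arrow the corresponding block of `B`. -/
def augment [DecidableEq Q] (W : QuiverRep F Q) (σ : Q → ℤ) (d : ℕ)
    (B : W.BlowupCopies (weightNeg σ) d →ₗ[F] W.BlowupCopies (weightPos σ) d) :
    QuiverRep F (AugQuiver Q σ d) where
  obj x := W.obj x
  addCommGroup x := W.addCommGroup x
  module x := W.module x
  finite x := W.finite x
  map a := W.augmentMap σ d B a

/-- A subrepresentation of the augmented representation is one of `W`. -/
def Subrep.restrict [DecidableEq Q] {W : QuiverRep F Q} {σ : Q → ℤ} {d : ℕ}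
    {B : W.BlowupCopies (weightNeg σ) d →ₗ[F] W.BlowupCopies (weightPos σ) d}
    (S : (W.augment σ d B).Subrep) : W.Subrep where
  space x := S.space x
  stable {x y} a := S.stable (x := x) (y := y) (Sum.inl a)

/-- `K(x)`: the sum of the projections of `ker A` to the copies of `W(x)`
(zero if `σ(x) ≤ 0`, as there are no copies then). -/
def kernelSpaces (W : QuiverRep F Q) (σ : Q → ℤ) (d : ℕ)
    (A : W.BlowupCopies (weightPos σ) d →ₗ[F] W.BlowupCopies (weightNeg σ) d) (x : Q) :
    Submodule F (W.obj x) :=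
  ⨆ i : Fin d × Fin (weightPos σ x), (LinearMap.ker A).map (W.copyProj (weightPos σ) d x i)

/-- The subrepresentation `W'` of `W`: the smallest subrepresentation of the augmented
representation containing all `K(x)`. -/
def wongSubrep [DecidableEq Q] (W : QuiverRep F Q) (σ : Q → ℤ) (d : ℕ)
    (A : W.BlowupCopies (weightPos σ) d →ₗ[F] W.BlowupCopies (weightNeg σ) d)
    (B : W.BlowupCopies (weightNeg σ) d →ₗ[F] W.BlowupCopies (weightPos σ) d) : W.Subrep :=
  ((W.augment σ d B).generatedSubrep (W.kernelSpaces σ d A)).restrict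

end QuiverRep

end

/-! A subspace shrunk by `k` forces `dim ker T ≥ k` for every `T` in the space, and its `e`-th power
is shrunk by `k e` for the `e`-th blow-up. So shrunk subspaces bound `ncrk` from above, and what is
missing is a subspace shrunk by exactly `dim ker A` for the `d`-th blow-up.

Such a subspace is the limit `U` of a Wong sequence: the smallest subspace that contains `ker A` and
is stable under `B T` for all `T` in the blow-up. The crucial point
(`IsPseudoInverse.apply_mem_range`) is that every `T` maps `U` into the image of `A`. A chain of
steps `B T` from `ker A` that escaped this image could be assembled into a block matrix in a further
blow-up with rank above the corresponding multiple of `rk A`, which the hypothesis on `A` excludes.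
Hence the image of `U` is `A U`, of dimension `dim U - dim ker A`. Conversely, equality in the
dimension count makes every subspace shrunk by `dim ker A` contain `ker A` and absorb `B` of its
image, so `U` lies in all of them.

The quiver enters through `eq_blowupSubspace_projSubrep`. Let `S` be the subrepresentation generated
by the projections of a maximally shrunk `U`. Passing from `U` to the sum of copies of `S` can only
enlarge the source, while the image stays the same, because path maps can be placed in single
blocks. Maximality then forces equality, so maximally shrunk subspaces come from subrepresentations.
This identifies the limit with the copies of `W'`, and counting dimensions gives its weight. -/

/-! ### Ranks, blow-ups and shrunk subspaces -/

section MatrixSpaceLemmas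

open Module

variable {F : Type*} [Field F]
variable {V : Type*} [AddCommGroup V] [Module F V]
variable {V' : Type*} [AddCommGroup V'] [Module F V']

theorem finrank_submodulePi {ι : Type*} [Fintype ι] {M : ι → Type*} [∀ i, AddCommGroup (M i)]
    [∀ i, Module F (M i)] [∀ i, Module.Finite F (M i)] (p : ∀ i, Submodule F (M i)) :
    finrank F (Submodule.pi Set.univ p) = ∑ i, finrank F (p i) := by
  let e : (Submodule.pi Set.univ p) ≃ₗ[F] (∀ i, p i) :=
    { toFun := fun v i => ⟨v.1 i, v.2 i trivial⟩
      invFun := fun v => ⟨fun i => (v i).1, fun i _ => (v i).2⟩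
      map_add' := fun _ _ => rfl
      map_smul' := fun _ _ => rfl
      left_inv := fun _ => rfl
      right_inv := fun _ => rfl }
  rw [e.finrank_eq, finrank_pi_fintype]

/-- If all blocks of `T` map `p i` into `q j`, then `T` maps the product of the `p i` into the
product of the `q j`. -/
theorem map_submodulePi_le {ι κ : Type*} [Fintype ι] [DecidableEq ι] {M : ι → Type*}
    [∀ i, AddCommGroup (M i)] [∀ i, Module F (M i)] {N : κ → Type*}
    [∀ i, AddCommGroup (N i)] [∀ i, Module F (N i)] (T : (∀ i, M i) →ₗ[F] (∀ j, N j))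
    (p : ∀ i, Submodule F (M i)) (q : ∀ j, Submodule F (N j))
    (h : ∀ i j, (p i).map (LinearMap.proj j ∘ₗ T ∘ₗ LinearMap.single F M i) ≤ q j) :
    (Submodule.pi Set.univ p).map T ≤ Submodule.pi Set.univ q := by
  rintro _ ⟨v, hv, rfl⟩ j -
  have hsum : T v = ∑ i, T (Pi.single i (v i)) := by
    rw [← map_sum, Finset.univ_sum_single]
  rw [hsum, Finset.sum_apply]
  exact Submodule.sum_mem _ fun i _ => h i j ⟨v i, hv i trivial, rfl⟩

theorem map_pi_le_of_mem_blowup {𝒜 : Submodule F (V →ₗ[F] V')} {U : Submodule F V}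
    {Z : Submodule F V'} (h : ∀ T ∈ 𝒜, U.map T ≤ Z) {d : ℕ}
    {T : (Fin d → V) →ₗ[F] (Fin d → V')} (hT : T ∈ blowup 𝒜 d) :
    (Submodule.pi Set.univ fun _ : Fin d => U).map T ≤
      Submodule.pi Set.univ fun _ : Fin d => Z :=
  map_submodulePi_le T _ _ fun i j => h _ (hT j i)

theorem single_comp_proj_mem_blowup {𝒜 : Submodule F (V →ₗ[F] V')} {T : V →ₗ[F] V'}
    (hT : T ∈ 𝒜) {d : ℕ} (i j : Fin d) :
    LinearMap.single F (fun _ : Fin d => V') j ∘ₗ T ∘ₗ LinearMap.proj i ∈ blowup 𝒜 d := by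
  intro j' i'
  by_cases hj : j' = j
  · by_cases hi : i' = i
    · subst hj hi
      convert hT using 1
      ext v
      simp
    · convert 𝒜.zero_mem using 1
      ext v
      simp [Pi.single_eq_of_ne (Ne.symm hi)]
  · convert 𝒜.zero_mem using 1
    ext v
    simp [Pi.single_eq_of_ne hj]

theorem map_le_spaceImage {𝒜 : Submodule F (V →ₗ[F] V')} {T : V →ₗ[F] V'} (hT : T ∈ 𝒜)
    (U : Submodule F V) : U.map T ≤ spaceImage 𝒜 U :=
  le_iSup₂_of_le T hT le_rfl

theorem spaceImage_le {𝒜 : Submodule F (V →ₗ[F] V')} {U : Submodule F V} {Z : Submodule F V'}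
    (h : ∀ T ∈ 𝒜, U.map T ≤ Z) : spaceImage 𝒜 U ≤ Z :=
  iSup₂_le h

theorem spaceImage_mono (𝒜 : Submodule F (V →ₗ[F] V')) {U U' : Submodule F V} (h : U ≤ U') :
    spaceImage 𝒜 U ≤ spaceImage 𝒜 U' :=
  spaceImage_le fun _ hT => (Submodule.map_mono h).trans (map_le_spaceImage hT U')

/-- The image is the smallest admissible `Z`, so the existential can be eliminated. -/
theorem isShrunk_iff [FiniteDimensional F V'] (𝒜 : Submodule F (V →ₗ[F] V')) (k : ℝ)
    (U : Submodule F V) :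
    IsShrunk 𝒜 k U ↔ (finrank F (spaceImage 𝒜 U) : ℝ) ≤ (finrank F U : ℝ) - k := by
  constructor
  · rintro ⟨Z, hZ, h⟩
    refine le_trans ?_ hZ
    exact_mod_cast Submodule.finrank_mono (spaceImage_le h)
  · exact fun h => ⟨_, h, fun T hT => map_le_spaceImage hT U⟩

theorem finrank_le_finrank_map_add_ker [FiniteDimensional F V] (T : V →ₗ[F] V')
    (U : Submodule F V) :
    finrank F U ≤ finrank F (U.map T) + finrank F (LinearMap.ker T) := by
  have h := (T.domRestrict U).finrank_range_add_finrank_ker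
  rw [LinearMap.range_domRestrict] at h
  have h2 : finrank F (LinearMap.ker (T.domRestrict U)) ≤ finrank F (LinearMap.ker T) := by
    rw [LinearMap.ker_domRestrict, ← Submodule.finrank_map_subtype_eq]
    exact Submodule.finrank_mono (Submodule.map_comap_subtype U _ ▸ inf_le_right)
  omega

theorem finrank_le_finrank_spaceImage_add_ker [FiniteDimensional F V] [FiniteDimensional F V']
    {𝒜 : Submodule F (V →ₗ[F] V')} {T : V →ₗ[F] V'} (hT : T ∈ 𝒜) (U : Submodule F V) :
    finrank F U ≤ finrank F (spaceImage 𝒜 U) + finrank F (LinearMap.ker T) :=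
  (finrank_le_finrank_map_add_ker T U).trans
    (Nat.add_le_add_right (Submodule.finrank_mono (map_le_spaceImage hT U)) _)

/-- Rank-nullity on `U`: a single `T` can lower the dimension of `U` by at most `dim ker T`. -/
theorem IsShrunk.le_finrank_ker [FiniteDimensional F V] [FiniteDimensional F V']
    {𝒜 : Submodule F (V →ₗ[F] V')} {k : ℝ} {U : Submodule F V} (hU : IsShrunk 𝒜 k U)
    {T : V →ₗ[F] V'} (hT : T ∈ 𝒜) : k ≤ finrank F (LinearMap.ker T) := by
  have h1 := (isShrunk_iff 𝒜 k U).1 hU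
  have h2 : (finrank F U : ℝ) ≤ finrank F (spaceImage 𝒜 U) + finrank F (LinearMap.ker T) :=
    mod_cast finrank_le_finrank_spaceImage_add_ker hT U
  linarith

theorem IsShrunk.pi [FiniteDimensional F V] [FiniteDimensional F V']
    {𝒜 : Submodule F (V →ₗ[F] V')} {k : ℝ} {U : Submodule F V} (hU : IsShrunk 𝒜 k U) (d : ℕ) :
    IsShrunk (blowup 𝒜 d) (k * d) (Submodule.pi Set.univ fun _ : Fin d => U) := by
  obtain ⟨Z, hZ, h⟩ := hU
  refine ⟨Submodule.pi Set.univ fun _ => Z, ?_, fun T hT => map_pi_le_of_mem_blowup h hT⟩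
  rw [finrank_submodulePi, finrank_submodulePi]
  simp only [Finset.sum_const, Finset.card_univ, Fintype.card_fin, smul_eq_mul, Nat.cast_mul]
  nlinarith [Nat.cast_nonneg (α := ℝ) d]

theorem finrank_range_le_matrixSpaceRank [FiniteDimensional F V]
    {𝒜 : Submodule F (V →ₗ[F] V')} {T : V →ₗ[F] V'} (hT : T ∈ 𝒜) :
    finrank F (LinearMap.range T) ≤ matrixSpaceRank 𝒜 := by
  refine le_csSup ⟨finrank F V, ?_⟩ ⟨T, hT, rfl⟩
  rintro _ ⟨S, -, rfl⟩
  exact S.finrank_range_le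

theorem matrixSpaceRank_le {𝒜 : Submodule F (V →ₗ[F] V')} {n : ℕ}
    (h : ∀ T ∈ 𝒜, finrank F (LinearMap.range T) ≤ n) : matrixSpaceRank 𝒜 ≤ n := by
  refine csSup_le ⟨_, 0, 𝒜.zero_mem, rfl⟩ ?_
  rintro _ ⟨S, hS, rfl⟩
  exact h S hS

theorem exists_finrank_range_eq_matrixSpaceRank [FiniteDimensional F V]
    (𝒜 : Submodule F (V →ₗ[F] V')) :
    ∃ T ∈ 𝒜, finrank F (LinearMap.range T) = matrixSpaceRank 𝒜 := by
  refine Nat.sSup_mem (s := {r : ℕ | ∃ T ∈ 𝒜, finrank F (LinearMap.range T) = r})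
    ⟨_, 0, 𝒜.zero_mem, rfl⟩ ⟨finrank F V, ?_⟩
  rintro _ ⟨S, -, rfl⟩
  exact S.finrank_range_le

theorem matrixSpaceRank_div_le_ncrk [FiniteDimensional F V] (𝒜 : Submodule F (V →ₗ[F] V'))
    {e : ℕ} (he : 1 ≤ e) : (matrixSpaceRank (blowup 𝒜 e) : ℝ) / e ≤ ncrk 𝒜 := by
  -- Boundedness matters: an unbounded real supremum would default to `0`. The bound `dim V` holds
  -- since ranks in the `e`-th blow-up are at most `e * dim V`.
  refine le_ciSup (f := fun e : ℕ+ => (matrixSpaceRank (blowup 𝒜 (e : ℕ)) : ℝ) / ((e : ℕ) : ℝ))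
    ⟨finrank F V, ?_⟩ ⟨e, he⟩
  rintro _ ⟨m, rfl⟩
  have hm : (0 : ℝ) < ((m : ℕ) : ℝ) := mod_cast m.pos
  rw [div_le_iff₀ hm]
  have : matrixSpaceRank (blowup 𝒜 (m : ℕ)) ≤ finrank F V * m :=
    matrixSpaceRank_le fun T _ => T.finrank_range_le.trans (by
      rw [finrank_pi_fintype, Finset.sum_const, Finset.card_univ, Fintype.card_fin, smul_eq_mul,
        mul_comm])
  exact_mod_cast this

theorem finrank_range_le_mul_ncrk [FiniteDimensional F V] {𝒜 : Submodule F (V →ₗ[F] V')}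
    {e : ℕ} (he : 1 ≤ e) {T : (Fin e → V) →ₗ[F] (Fin e → V')} (hT : T ∈ blowup 𝒜 e) :
    (finrank F (LinearMap.range T) : ℝ) ≤ e * ncrk 𝒜 := by
  have h1 : (finrank F (LinearMap.range T) : ℝ) ≤ matrixSpaceRank (blowup 𝒜 e) :=
    mod_cast finrank_range_le_matrixSpaceRank hT
  have h2 := matrixSpaceRank_div_le_ncrk 𝒜 he
  rw [div_le_iff₀ (by positivity)] at h2
  linarith

/-- A shrunk subspace bounds the non-commutative rank from above. -/
theorem IsShrunk.ncrk_le [FiniteDimensional F V] [FiniteDimensional F V']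
    {𝒜 : Submodule F (V →ₗ[F] V')} {k : ℝ} {U : Submodule F V} (hU : IsShrunk 𝒜 k U) :
    ncrk 𝒜 ≤ finrank F V - k := by
  refine ciSup_le fun e => ?_
  have he : (0 : ℝ) < ((e : ℕ) : ℝ) := mod_cast e.pos
  rw [div_le_iff₀ he]
  obtain ⟨T, hT, hr⟩ := exists_finrank_range_eq_matrixSpaceRank (blowup 𝒜 (e : ℕ))
  rw [← hr]
  have h1 := (hU.pi e).le_finrank_ker hT
  have h2 : (finrank F (LinearMap.range T) : ℝ) + finrank F (LinearMap.ker T) =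
      e * finrank F V := by
    have := T.finrank_range_add_finrank_ker
    rw [finrank_pi_fintype, Finset.sum_const, Finset.card_univ, Fintype.card_fin,
      smul_eq_mul] at this
    exact_mod_cast this
  linarith

end MatrixSpaceLemmas

/-! ### Pseudo-inverses and the Wong sequence -/

section PseudoInverse

open Module

variable {F : Type*} [Field F]
variable {V : Type*} [AddCommGroup V] [Module F V]
variable {V' : Type*} [AddCommGroup V'] [Module F V']

theorem IsPseudoInverse.apply_apply_of_mem_range {A : V →ₗ[F] V'} {B : V' →ₗ[F] V}
    (hB : IsPseudoInverse A B) {z : V'} (hz : z ∈ LinearMap.range A) : A (B z) = z := by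
  obtain ⟨C, hC, h⟩ := hB
  obtain ⟨v, rfl⟩ := hz
  obtain ⟨a, ha, c, hc, rfl⟩ := Submodule.mem_sup.1 (hC.sup_eq_top.ge (Submodule.mem_top (x := v)))
  rw [map_add, LinearMap.mem_ker.1 ha, zero_add, h c hc]

/-- `B (A u)` and `u` have the same image under `A`, so they differ by an element of `ker A`. -/
theorem IsPseudoInverse.apply_mem {A : V →ₗ[F] V'} {B : V' →ₗ[F] V}
    (hB : IsPseudoInverse A B) {U : Submodule F V} (hU : LinearMap.ker A ≤ U) {u : V}
    (hu : u ∈ U) : B (A u) ∈ U := by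
  have h : A (B (A u)) = A u := hB.apply_apply_of_mem_range ⟨u, rfl⟩
  have : B (A u) - u ∈ U := hU (by rw [LinearMap.mem_ker, map_sub, h, sub_self])
  simpa using U.add_mem this hu

/-- The lower bidiagonal block matrix with `A` on the diagonal and `-T i` below it. -/
noncomputable def bidiagonal (A : V →ₗ[F] V') (T : ℕ → (V →ₗ[F] V')) (k : ℕ) :
    (Fin (k + 1) → V) →ₗ[F] (Fin (k + 1) → V') :=
  LinearMap.pi (Fin.cons (A ∘ₗ LinearMap.proj 0)
    (fun i : Fin k => A ∘ₗ LinearMap.proj i.succ - T i ∘ₗ LinearMap.proj i.castSucc))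

theorem bidiagonal_zero (A : V →ₗ[F] V') (T : ℕ → (V →ₗ[F] V')) (k : ℕ) (v : Fin (k + 1) → V) :
    bidiagonal A T k v 0 = A (v 0) := rfl

theorem bidiagonal_succ (A : V →ₗ[F] V') (T : ℕ → (V →ₗ[F] V')) (k : ℕ) (v : Fin (k + 1) → V)
    (i : Fin k) : bidiagonal A T k v i.succ = A (v i.succ) - T i (v i.castSucc) := rfl

theorem bidiagonal_mem_blowup {𝒜 : Submodule F (V →ₗ[F] V')} {A : V →ₗ[F] V'} (hA : A ∈ 𝒜)
    {T : ℕ → (V →ₗ[F] V')} {k : ℕ} (hT : ∀ i < k, T i ∈ 𝒜) :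
    bidiagonal A T k ∈ blowup 𝒜 (k + 1) := by
  have key : ∀ S ∈ 𝒜, ∀ i j : Fin (k + 1),
      S ∘ₗ LinearMap.proj i ∘ₗ LinearMap.single F (fun _ : Fin (k + 1) => V) j ∈ 𝒜 := by
    intro S hS i j
    by_cases h : i = j
    · subst h
      rwa [LinearMap.proj_comp_single_same, LinearMap.comp_id]
    · rw [LinearMap.proj_comp_single_ne _ _ _ _ h, LinearMap.comp_zero]
      exact 𝒜.zero_mem
  intro i j
  induction i using Fin.cases with
  | zero => exact key A hA 0 j
  | succ i => exact 𝒜.sub_mem (key A hA i.succ j) (key (T i) (hT i i.2) i.castSucc j)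

/-- If `A` has the largest rank even among blow-ups, then a sequence starting in `ker A` and
continued by `w (i + 1) = B (T i (w i))` never leaves the image of `A`. -/
theorem IsPseudoInverse.apply_mem_range [FiniteDimensional F V] [FiniteDimensional F V']
    {𝒜 : Submodule F (V →ₗ[F] V')} {A : V →ₗ[F] V'} {B : V' →ₗ[F] V}
    (hB : IsPseudoInverse A B) (hA : A ∈ 𝒜)
    (hmax : ∀ e : ℕ, 1 ≤ e → ∀ T ∈ blowup 𝒜 e,
      finrank F (LinearMap.range T) ≤ e * finrank F (LinearMap.range A))
    (k : ℕ) (T : ℕ → (V →ₗ[F] V')) (w : ℕ → V) (hT : ∀ i ≤ k, T i ∈ 𝒜)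
    (hw0 : w 0 ∈ LinearMap.ker A) (hw : ∀ i < k, w (i + 1) = B (T i (w i))) :
    T k (w k) ∈ LinearMap.range A := by
  induction k using Nat.strong_induction_on with
  | _ k ih =>
  -- By strong induction the chain has not escaped before step `k`, so `B` really inverts `A` along
  -- it.
  have hprev : ∀ i < k, A (w (i + 1)) = T i (w i) := fun i hi => by
    rw [hw i hi]
    exact hB.apply_apply_of_mem_range
      (ih i hi (fun j hj => hT j (hj.trans hi.le)) fun j hj => hw j (hj.trans hi))
  by_contra hk
  obtain ⟨C, hC, -⟩ := hB
  have hCinj : ∀ c ∈ C, A c = 0 → c = 0 := fun c hc h =>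
    (Submodule.disjoint_def.1 hC.disjoint) c h hc
  have hCrank : finrank F C = finrank F (LinearMap.range A) := by
    have h1 := Submodule.finrank_add_eq_of_isCompl hC
    have h2 := A.finrank_range_add_finrank_ker
    omega
  set M := bidiagonal A T (k + 1) with hM
  set P : Submodule F (Fin (k + 2) → V) := Submodule.pi Set.univ fun _ => C with hP
  -- Forward substitution: `A` is injective on `C`, so the vanishing of each entry of `c` passes to
  -- the next.
  have hvanish : ∀ c ∈ P, (∀ i : Fin (k + 1), M c i.castSucc = 0) →
      ∀ i : Fin (k + 1), c i.castSucc = 0 := by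
    intro c hc h i
    induction i using Fin.induction with
    | zero => exact hCinj _ (hc _ trivial) (h 0)
    | succ i hi =>
      refine hCinj _ (hc _ trivial) ?_
      have := h i.succ
      rw [← Fin.succ_castSucc, hM, bidiagonal_succ, hi, map_zero, sub_zero] at this
      exact this
  have hlast : ∀ c : Fin (k + 2) → V,
      M c (Fin.last (k + 1)) = A (c (Fin.last (k + 1))) - T k (c (Fin.last k).castSucc) :=
    fun c => bidiagonal_succ A T (k + 1) c (Fin.last k)
  have hinj : ∀ c ∈ P, M c = 0 → c = 0 := by
    intro c hc h
    have h0 := hvanish c hc fun i => by rw [h]; rfl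
    funext i
    induction i using Fin.lastCases with
    | cast i => exact h0 i
    | last =>
      refine hCinj _ (hc _ trivial) ?_
      have h1 := hlast c
      rw [h, h0, map_zero, sub_zero] at h1
      exact h1.symm
  have hdim : finrank F (P.map M) = (k + 2) * finrank F (LinearMap.range A) := by
    have h1 := (M.domRestrict P).finrank_range_add_finrank_ker
    have h2 : LinearMap.ker (M.domRestrict P) = ⊥ :=
      LinearMap.ker_eq_bot'.2 fun c hc => Subtype.ext (hinj c.1 c.2 hc)
    rw [LinearMap.range_domRestrict, h2, finrank_bot, add_zero, hP, finrank_submodulePi] at h1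
    rw [h1, Finset.sum_const, Finset.card_univ, Fintype.card_fin, smul_eq_mul, hCrank]
  -- The sums telescope: `M v` is zero except for its last entry `-T k (w k)`. Modulo the image of
  -- `A` this entry is nonzero, which adds at least one to the rank `(k + 2) * rk A` already reached
  -- on `P`.
  let v : Fin (k + 2) → V := Fin.snoc (fun i : Fin (k + 1) => w i) 0
  have hv : ∀ i : Fin (k + 1), v i.castSucc = w i := fun i => by simp [v]
  have hvl : v (Fin.last (k + 1)) = 0 := by simp [v]
  have hMv : ∀ i : Fin (k + 1), M v i.castSucc = 0 := by
    intro i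
    induction i using Fin.cases with
    | zero =>
      have := hv 0
      rw [Fin.castSucc_zero] at this ⊢
      rw [hM, bidiagonal_zero, this]
      exact hw0
    | succ i =>
      rw [← Fin.succ_castSucc, hM, bidiagonal_succ, hv, Fin.succ_castSucc, hv]
      exact sub_eq_zero.2 (hprev i i.2)
  have hnot : M v ∉ P.map M := by
    rintro ⟨c, hc, hcv⟩
    have h0 := hvanish c hc fun i => by rw [hcv]; exact hMv i
    have h1 := hlast c
    rw [hcv, hlast v, h0, map_zero, sub_zero, hvl, map_zero, hv, zero_sub] at h1
    exact hk ⟨-c (Fin.last (k + 1)), by rw [map_neg, ← h1]; exact neg_neg _⟩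
  have hlt : P.map M < LinearMap.range M :=
    lt_of_le_of_ne LinearMap.map_le_range fun h => hnot (h ▸ LinearMap.mem_range_self M v)
  have h1 := Submodule.finrank_lt_finrank_of_lt hlt
  have h2 := hmax (k + 2) (by omega) M
    (bidiagonal_mem_blowup hA fun i hi => hT i (Nat.lt_succ_iff.1 hi))
  rw [hdim] at h1
  exact absurd h2 (not_le.2 h1)

/-- If `A` has the largest rank even among blow-ups, then the smallest subspace containing `ker A`
and stable under `B T` for all `T` is mapped into the image of `A`. -/
theorem IsPseudoInverse.exists_stable [FiniteDimensional F V] [FiniteDimensional F V']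
    {𝒜 : Submodule F (V →ₗ[F] V')} {A : V →ₗ[F] V'} {B : V' →ₗ[F] V}
    (hB : IsPseudoInverse A B) (hA : A ∈ 𝒜)
    (hmax : ∀ e : ℕ, 1 ≤ e → ∀ T ∈ blowup 𝒜 e,
      finrank F (LinearMap.range T) ≤ e * finrank F (LinearMap.range A)) :
    ∃ U : Submodule F V, LinearMap.ker A ≤ U ∧
      (∀ T ∈ 𝒜, ∀ u ∈ U, T u ∈ LinearMap.range A ∧ B (T u) ∈ U) ∧
      ∀ U' : Submodule F V, LinearMap.ker A ≤ U' → (∀ T ∈ 𝒜, ∀ u ∈ U', B (T u) ∈ U') →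
        U ≤ U' := by
  -- Endpoints of all chains out of `ker A`. Recording whole chains lets `apply_mem_range` be
  -- applied after extending one by a single step.
  let R : Set V := {v | ∃ (k : ℕ) (T : ℕ → (V →ₗ[F] V')) (w : ℕ → V),
    w 0 ∈ LinearMap.ker A ∧ (∀ i < k, T i ∈ 𝒜 ∧ w (i + 1) = B (T i (w i))) ∧ w k = v}
  have hR : ∀ v ∈ R, ∀ T ∈ 𝒜, T v ∈ LinearMap.range A ∧ B (T v) ∈ R := by
    rintro _ ⟨k, T, w, h0, h, rfl⟩ S hS
    let T' : ℕ → (V →ₗ[F] V') := fun i => if i < k then T i else S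
    let w' : ℕ → V := fun i => if i ≤ k then w i else B (S (w k))
    have hT' : ∀ i, i < k → T' i = T i := fun i hi => if_pos hi
    have hTk : T' k = S := if_neg (lt_irrefl k)
    have hw' : ∀ i, i ≤ k → w' i = w i := fun i hi => if_pos hi
    have hwk : w' (k + 1) = B (S (w k)) := if_neg (by omega)
    have h0' : w' 0 ∈ LinearMap.ker A := by rw [hw' 0 (Nat.zero_le k)]; exact h0
    have hstep : ∀ i < k + 1, T' i ∈ 𝒜 ∧ w' (i + 1) = B (T' i (w' i)) := by
      intro i hi
      rcases Nat.lt_succ_iff_lt_or_eq.1 hi with hi | rfl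
      · rw [hT' i hi, hw' i hi.le, hw' (i + 1) hi]
        exact h i hi
      · rw [hTk, hwk, hw' i le_rfl]
        exact ⟨hS, rfl⟩
    refine ⟨?_, k + 1, T', w', h0', hstep, hwk⟩
    have := hB.apply_mem_range hA hmax k T' w' (fun i hi => (hstep i (by omega)).1) h0'
      fun i hi => (hstep i (by omega)).2
    rwa [hTk, hw' k le_rfl] at this
  refine ⟨Submodule.span F R, fun v hv => Submodule.subset_span
    ⟨0, fun _ => 0, fun _ => v, hv, fun i hi => absurd hi (Nat.not_lt_zero i), rfl⟩, ?_, ?_⟩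
  · intro T hT
    have : Submodule.span F R ≤
        (LinearMap.range A).comap T ⊓ (Submodule.span F R).comap (B ∘ₗ T) :=
      Submodule.span_le.2 fun v hv => ⟨(hR v hv T hT).1, Submodule.subset_span (hR v hv T hT).2⟩
    exact fun u hu => this hu
  · intro U' hker hst
    refine Submodule.span_le.2 ?_
    rintro _ ⟨k, T, w, h0, h, rfl⟩
    have : ∀ i ≤ k, w i ∈ U' := by
      intro i
      induction i with
      | zero => exact fun _ => hker h0
      | succ i ih =>
        intro hi
        rw [(h i hi).2]
        exact hst _ (h i hi).1 _ (ih (by omega))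
    exact this k le_rfl

/-- The dimension count for a subspace that contains `ker A` and whose image lies in the image
of `A` and is mapped back by `B`. -/
theorem IsPseudoInverse.finrank_eq_of_stable [FiniteDimensional F V] [FiniteDimensional F V']
    {𝒜 : Submodule F (V →ₗ[F] V')} {A : V →ₗ[F] V'} {B : V' →ₗ[F] V}
    (hB : IsPseudoInverse A B) (hA : A ∈ 𝒜) {U : Submodule F V} (hker : LinearMap.ker A ≤ U)
    (hst : ∀ T ∈ 𝒜, ∀ u ∈ U, T u ∈ LinearMap.range A ∧ B (T u) ∈ U) :
    finrank F U = finrank F (spaceImage 𝒜 U) + finrank F (LinearMap.ker A) := by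
  refine (finrank_le_finrank_spaceImage_add_ker hA U).antisymm ?_
  -- The vector `B (T u)` in `U` is a preimage of `T u` under `A`, so `A` alone produces the whole
  -- image.
  have himg : spaceImage 𝒜 U ≤ U.map A := spaceImage_le fun T hT => by
    rintro _ ⟨u, hu, rfl⟩
    exact ⟨B (T u), (hst T hT u hu).2, hB.apply_apply_of_mem_range (hst T hT u hu).1⟩
  have h1 := (A.domRestrict U).finrank_range_add_finrank_ker
  rw [LinearMap.range_domRestrict, LinearMap.ker_domRestrict,
    ← Submodule.finrank_map_subtype_eq, Submodule.map_comap_subtype,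
    inf_eq_right.2 hker] at h1
  have h2 := Submodule.finrank_mono himg
  omega

/-- A subspace that is shrunk as much as possible contains `ker A`, and `B` maps its image back
into it. -/
theorem IsPseudoInverse.stable_of_finrank_le [FiniteDimensional F V] [FiniteDimensional F V']
    {𝒜 : Submodule F (V →ₗ[F] V')} {A : V →ₗ[F] V'} {B : V' →ₗ[F] V}
    (hB : IsPseudoInverse A B) (hA : A ∈ 𝒜) {U : Submodule F V}
    (hU : finrank F (spaceImage 𝒜 U) + finrank F (LinearMap.ker A) ≤ finrank F U) :
    LinearMap.ker A ≤ U ∧ ∀ z ∈ spaceImage 𝒜 U, B z ∈ U := by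
  have h1 := (A.domRestrict U).finrank_range_add_finrank_ker
  rw [LinearMap.range_domRestrict, LinearMap.ker_domRestrict,
    ← Submodule.finrank_map_subtype_eq, Submodule.map_comap_subtype] at h1
  have h2 := Submodule.finrank_mono (map_le_spaceImage hA U)
  have h3 : finrank F (U ⊓ LinearMap.ker A : Submodule F V) ≤ finrank F (LinearMap.ker A) :=
    Submodule.finrank_mono inf_le_right
  have hker : LinearMap.ker A ≤ U :=
    inf_eq_right.1 (Submodule.eq_of_le_of_finrank_le inf_le_right (by omega))
  have himg : U.map A = spaceImage 𝒜 U :=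
    Submodule.eq_of_le_of_finrank_le (map_le_spaceImage hA U) (by omega)
  refine ⟨hker, fun z hz => ?_⟩
  rw [← himg] at hz
  obtain ⟨u, hu, rfl⟩ := hz
  exact hB.apply_mem hker hu

end PseudoInverse

/-! ### Subrepresentations and sums of their copies -/

namespace QuiverRep

open Module

variable {F : Type*} [Field F] {Q : Type*} [Quiver Q]

theorem Subrep.pathMap_mem {W : QuiverRep F Q} (S : W.Subrep) {x y : Q} (p : Quiver.Path x y)
    {w : W.obj x} (hw : w ∈ S.space x) : W.pathMap p w ∈ S.space y := by
  induction p with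
  | nil => exact hw
  | cons p a ih => exact S.stable a ⟨_, ih, rfl⟩

/-- The subspace `⨁ₓ S(x) ^ m(x)` of `⨁ₓ W(x) ^ m(x)`. -/
def copiesSubspace (W : QuiverRep F Q) (S : ∀ x, Submodule F (W.obj x)) (m : Q → ℕ) :
    Submodule F (W.Copies m) :=
  Submodule.pi Set.univ fun s : Σ x : Q, Fin (m x) => S s.1

theorem blowupSubspace_eq_pi (W : QuiverRep F Q) (S : ∀ x, Submodule F (W.obj x)) (m : Q → ℕ)
    (d : ℕ) : W.blowupSubspace S m d =
      Submodule.pi Set.univ fun _ : Fin d => W.copiesSubspace S m :=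
  Submodule.ext fun _ => ⟨fun h i _ s _ => h i s, fun h i s => h i trivial s trivial⟩

theorem blowupSubspace_mono (W : QuiverRep F Q) {S S' : ∀ x, Submodule F (W.obj x)}
    (h : ∀ x, S x ≤ S' x) (m : Q → ℕ) (d : ℕ) :
    W.blowupSubspace S m d ≤ W.blowupSubspace S' m d :=
  fun _ hv i s => h s.1 (hv i s)

section Fintype

variable [Fintype Q]

theorem finrank_copiesSubspace (W : QuiverRep F Q) (S : ∀ x, Submodule F (W.obj x)) (m : Q → ℕ) :
    finrank F (W.copiesSubspace S m) = ∑ x, m x * finrank F (S x) := by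
  rw [copiesSubspace, finrank_submodulePi, Fintype.sum_sigma]
  refine Finset.sum_congr rfl fun x _ => ?_
  change ∑ _ : Fin (m x), finrank F (S x) = _
  rw [Finset.sum_const, Finset.card_univ, Fintype.card_fin, smul_eq_mul]

theorem finrank_blowupSubspace (W : QuiverRep F Q) (S : ∀ x, Submodule F (W.obj x)) (m : Q → ℕ)
    (d : ℕ) : finrank F (W.blowupSubspace S m d) = d * finrank F (W.copiesSubspace S m) := by
  rw [blowupSubspace_eq_pi, finrank_submodulePi]
  simp

theorem Subrep.weight_eq {W : QuiverRep F Q} (S : W.Subrep) (σ : Q → ℤ) :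
    S.weight σ = (finrank F (W.copiesSubspace S.space (weightPos σ)) : ℤ) -
      finrank F (W.copiesSubspace S.space (weightNeg σ)) := by
  rw [finrank_copiesSubspace, finrank_copiesSubspace, Subrep.weight]
  push_cast
  rw [← Finset.sum_sub_distrib]
  refine Finset.sum_congr rfl fun x _ => ?_
  rw [← sub_mul, weightPos, weightNeg, Int.toNat_sub_toNat_neg]

end Fintype

theorem sum_copyIncl [Fintype Q] [DecidableEq Q] (W : QuiverRep F Q) (m : Q → ℕ) (d : ℕ)
    (v : W.BlowupCopies m d) :
    v = ∑ i : Fin d, ∑ s : (Σ x : Q, Fin (m x)), W.copyIncl m d s.1 (i, s.2) (v i s) := by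
  conv_lhs => rw [← Finset.univ_sum_single v]
  refine Finset.sum_congr rfl fun i _ => ?_
  conv_lhs => rw [← Finset.univ_sum_single (v i)]
  exact map_sum (LinearMap.single F (fun _ : Fin d => W.Copies m) i) _ _

/-- The subrepresentation of `W` generated by the projections of `U` to the copies of the
spaces `W(x)`. -/
def projSubrep (W : QuiverRep F Q) (m : Q → ℕ) (d : ℕ) (U : Submodule F (W.BlowupCopies m d)) :
    W.Subrep where
  space y := ⨆ (x : Q) (p : Quiver.Path x y) (i : Fin d × Fin (m x)),
    U.map (W.pathMap p ∘ₗ W.copyProj m d x i)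
  stable {y z} a := by
    simp only [Submodule.map_iSup, ← Submodule.map_comp]
    exact iSup_le fun x => iSup_le fun p => iSup_le fun i =>
      le_iSup_of_le x (le_iSup_of_le (p.cons a) (le_iSup_of_le i le_rfl))

theorem copyProj_mem_projSubrep (W : QuiverRep F Q) (m : Q → ℕ) (d : ℕ)
    {U : Submodule F (W.BlowupCopies m d)} {u : W.BlowupCopies m d} (hu : u ∈ U) (x : Q)
    (i : Fin d × Fin (m x)) : W.copyProj m d x i u ∈ (W.projSubrep m d U).space x :=
  Submodule.mem_iSup_of_mem x (Submodule.mem_iSup_of_mem Quiver.Path.nil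
    (Submodule.mem_iSup_of_mem i ⟨u, hu, rfl⟩))

theorem le_blowupSubspace_projSubrep (W : QuiverRep F Q) (m : Q → ℕ) (d : ℕ)
    (U : Submodule F (W.BlowupCopies m d)) :
    U ≤ W.blowupSubspace (W.projSubrep m d U).space m d :=
  fun _ hu i s => W.copyProj_mem_projSubrep m d hu s.1 (i, s.2)

theorem copyIncl_mem_blowupSubspace [DecidableEq Q] (W : QuiverRep F Q)
    (S : ∀ x, Submodule F (W.obj x)) (m : Q → ℕ) (d : ℕ) (x : Q) (i : Fin d × Fin (m x))
    {w : W.obj x} (hw : w ∈ S x) : W.copyIncl m d x i w ∈ W.blowupSubspace S m d := by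
  rw [blowupSubspace_eq_pi]
  exact Submodule.le_comap_single_pi (fun _ => W.copiesSubspace S m)
    (Submodule.le_comap_single_pi (fun s : Σ x : Q, Fin (m x) => S s.1) hw)

/-! ### The matrix space of a weight and its images -/

section WeightSpace

variable [DecidableEq Q]

theorem single_comp_pathMap_mem_weightSpace (W : QuiverRep F Q) (σ : Q → ℤ) {x y : Q}
    (p : Quiver.Path x y) (i : Fin (weightPos σ x)) (j : Fin (weightNeg σ y)) :
    LinearMap.single F (fun t : Σ y : Q, Fin (weightNeg σ y) => W.obj t.1) ⟨y, j⟩ ∘ₗ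
        W.pathMap p ∘ₗ
        (LinearMap.proj (⟨x, i⟩ : Σ x : Q, Fin (weightPos σ x)) :
          W.Copies (weightPos σ) →ₗ[F] W.obj x) ∈ W.weightSpace σ := by
  intro s t
  by_cases ht : t = ⟨y, j⟩
  · by_cases hs : s = ⟨x, i⟩
    · subst hs ht
      have h : W.pathMap p ∈ Submodule.span F (Set.range fun p : Quiver.Path x y => W.pathMap p) :=
        Submodule.subset_span (Set.mem_range_self p)
      convert h using 1
      ext w
      simp
    · convert Submodule.zero_mem _ using 1
      ext w
      simp [Pi.single_eq_of_ne (Ne.symm hs)]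
  · convert Submodule.zero_mem _ using 1
    ext w
    simp [Pi.single_eq_of_ne ht]

theorem copyIncl_pathMap_mem_spaceImage (W : QuiverRep F Q) (σ : Q → ℤ) (d : ℕ)
    {U : Submodule F (W.BlowupCopies (weightPos σ) d)} {u : W.BlowupCopies (weightPos σ) d}
    (hu : u ∈ U) {x y : Q} (p : Quiver.Path x y) (i : Fin d × Fin (weightPos σ x))
    (j : Fin d × Fin (weightNeg σ y)) :
    W.copyIncl (weightNeg σ) d y j (W.pathMap p (W.copyProj (weightPos σ) d x i u)) ∈
      spaceImage (blowup (W.weightSpace σ) d) U :=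
  map_le_spaceImage (single_comp_proj_mem_blowup
    (W.single_comp_pathMap_mem_weightSpace σ p i.2 j.2) i.1 j.1) U ⟨u, hu, rfl⟩

section Fintype

variable [Fintype Q]

theorem Subrep.map_copiesSubspace_le {W : QuiverRep F Q} (S : W.Subrep) (σ : Q → ℤ)
    {T : W.Copies (weightPos σ) →ₗ[F] W.Copies (weightNeg σ)} (hT : T ∈ W.weightSpace σ) :
    (W.copiesSubspace S.space (weightPos σ)).map T ≤
      W.copiesSubspace S.space (weightNeg σ) := by
  refine map_submodulePi_le T _ _ fun s t => ?_
  rintro _ ⟨w, hw, rfl⟩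
  have hspan : Submodule.span F (Set.range fun p : Quiver.Path s.1 t.1 => W.pathMap p) ≤
      (S.space t.1).comap (LinearMap.applyₗ w) :=
    Submodule.span_le.2 fun _ ⟨p, hp⟩ => hp ▸ S.pathMap_mem p hw
  exact hspan (hT s t)

theorem Subrep.map_blowupSubspace_le {W : QuiverRep F Q} (S : W.Subrep) (σ : Q → ℤ) {d : ℕ}
    {T : W.BlowupCopies (weightPos σ) d →ₗ[F] W.BlowupCopies (weightNeg σ) d}
    (hT : T ∈ blowup (W.weightSpace σ) d) :
    (W.blowupSubspace S.space (weightPos σ) d).map T ≤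
      W.blowupSubspace S.space (weightNeg σ) d := by
  rw [blowupSubspace_eq_pi, blowupSubspace_eq_pi]
  exact map_pi_le_of_mem_blowup (fun _ h => S.map_copiesSubspace_le σ h) hT

theorem Subrep.spaceImage_blowupSubspace_le {W : QuiverRep F Q} (S : W.Subrep) (σ : Q → ℤ)
    (d : ℕ) : spaceImage (blowup (W.weightSpace σ) d) (W.blowupSubspace S.space (weightPos σ) d) ≤
      W.blowupSubspace S.space (weightNeg σ) d :=
  spaceImage_le fun _ hT => S.map_blowupSubspace_le σ hT

/-- The link between witnesses and shrunk subspaces: blocks are combinations of path maps, so they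
preserve `S`, and the weight is the difference of the two dimensions. -/
theorem Subrep.isShrunk {W : QuiverRep F Q} (S : W.Subrep) (σ : Q → ℤ) :
    IsShrunk (W.weightSpace σ) (S.weight σ) (W.copiesSubspace S.space (weightPos σ)) := by
  refine ⟨_, le_of_eq ?_, fun _ h => S.map_copiesSubspace_le σ h⟩
  rw [S.weight_eq]
  push_cast
  ring

end Fintype

theorem copyIncl_mem_spaceImage (W : QuiverRep F Q) (σ : Q → ℤ) (d : ℕ)
    (U : Submodule F (W.BlowupCopies (weightPos σ) d)) (y : Q) (j : Fin d × Fin (weightNeg σ y))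
    {w : W.obj y} (hw : w ∈ (W.projSubrep (weightPos σ) d U).space y) :
    W.copyIncl (weightNeg σ) d y j w ∈ spaceImage (blowup (W.weightSpace σ) d) U := by
  have h : (W.projSubrep (weightPos σ) d U).space y ≤
      (spaceImage (blowup (W.weightSpace σ) d) U).comap (W.copyIncl (weightNeg σ) d y j) := by
    refine iSup_le fun x => iSup_le fun p => iSup_le fun i => ?_
    rintro _ ⟨u, hu, rfl⟩
    exact W.copyIncl_pathMap_mem_spaceImage σ d hu p i j
  exact h hw

/-- Matrices with a single nonzero block `W(p)` lie in the blow-up; they carry any projection of `U`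
along any path into any chosen copy in the target. -/
theorem blowupSubspace_projSubrep_le_spaceImage [Fintype Q] (W : QuiverRep F Q) (σ : Q → ℤ)
    (d : ℕ) (U : Submodule F (W.BlowupCopies (weightPos σ) d)) :
    W.blowupSubspace (W.projSubrep (weightPos σ) d U).space (weightNeg σ) d ≤
      spaceImage (blowup (W.weightSpace σ) d) U := by
  intro v hv
  rw [W.sum_copyIncl (weightNeg σ) d v]
  exact Submodule.sum_mem _ fun i _ => Submodule.sum_mem _ fun s _ =>
    W.copyIncl_mem_spaceImage σ d U s.1 (i, s.2) (hv i s)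

/-! ### The subrepresentation `W'` as the limit of the Wong sequence -/

section Wong

variable {W : QuiverRep F Q} {σ : Q → ℤ} {d : ℕ}
  {A : W.BlowupCopies (weightPos σ) d →ₗ[F] W.BlowupCopies (weightNeg σ) d}
  {B : W.BlowupCopies (weightNeg σ) d →ₗ[F] W.BlowupCopies (weightPos σ) d}

theorem ker_le_blowupSubspace_wongSubrep :
    LinearMap.ker A ≤ W.blowupSubspace (W.wongSubrep σ d A B).space (weightPos σ) d := by
  intro v hv i s
  have h : W.kernelSpaces σ d A s.1 ≤ (W.wongSubrep σ d A B).space s.1 :=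
    (W.augment σ d B).le_generatedSubrep (W.kernelSpaces σ d A) s.1
  exact h (Submodule.mem_iSup_of_mem (i, s.2) ⟨v, hv, rfl⟩)

theorem apply_mem_blowupSubspace_wongSubrep [Fintype Q] {z : W.BlowupCopies (weightNeg σ) d}
    (hz : z ∈ W.blowupSubspace (W.wongSubrep σ d A B).space (weightNeg σ) d) :
    B z ∈ W.blowupSubspace (W.wongSubrep σ d A B).space (weightPos σ) d := by
  rw [W.sum_copyIncl (weightNeg σ) d z, map_sum]
  refine Submodule.sum_mem _ fun j _ => ?_
  rw [map_sum]
  refine Submodule.sum_mem _ fun t _ => fun i s => ?_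
  have h : ((W.wongSubrep σ d A B).space t.1).map
      (W.augmentMap σ d B (Sum.inr ((j, t.2), (i, s.2)))) ≤ (W.wongSubrep σ d A B).space s.1 :=
    ((W.augment σ d B).generatedSubrep (W.kernelSpaces σ d A)).stable
      (x := t.1) (y := s.1) (Sum.inr ((j, t.2), (i, s.2)))
  exact h ⟨z j t, hz j t, rfl⟩

/-- Stability under `B` makes `S` a subrepresentation of the augmented representation, so minimality
of the generated one applies. -/
theorem wongSubrep_le (S : W.Subrep)
    (hker : LinearMap.ker A ≤ W.blowupSubspace S.space (weightPos σ) d)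
    (hst : ∀ z ∈ W.blowupSubspace S.space (weightNeg σ) d,
      B z ∈ W.blowupSubspace S.space (weightPos σ) d) (x : Q) :
    (W.wongSubrep σ d A B).space x ≤ S.space x := by
  let S' : (W.augment σ d B).Subrep :=
    { space := fun x => S.space x
      stable := by
        rintro x y (a | ⟨j, i⟩)
        · exact S.stable a
        · rintro _ ⟨w, hw, rfl⟩
          exact hst _ (W.copyIncl_mem_blowupSubspace S.space (weightNeg σ) d x j hw) i.1
            ⟨y, i.2⟩ }
  refine (W.augment σ d B).generatedSubrep_le (W.kernelSpaces σ d A) S' (fun z => ?_) x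
  refine iSup_le fun i => ?_
  rintro _ ⟨v, hv, rfl⟩
  exact hker hv i.1 ⟨z, i.2⟩

/-- If `U` is shrunk as much as possible, then `U` is the sum of the copies of the spaces of
`projSubrep`, and its image is the sum of the copies of the same spaces. -/
theorem eq_blowupSubspace_projSubrep [Fintype Q] (hA : A ∈ blowup (W.weightSpace σ) d)
    {U : Submodule F (W.BlowupCopies (weightPos σ) d)}
    (hU : finrank F (spaceImage (blowup (W.weightSpace σ) d) U) +
      finrank F (LinearMap.ker A) ≤ finrank F U) :
    U = W.blowupSubspace (W.projSubrep (weightPos σ) d U).space (weightPos σ) d ∧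
      spaceImage (blowup (W.weightSpace σ) d) U =
        W.blowupSubspace (W.projSubrep (weightPos σ) d U).space (weightNeg σ) d := by
  have h1 := W.le_blowupSubspace_projSubrep (weightPos σ) d U
  have h2 := (W.projSubrep (weightPos σ) d U).spaceImage_blowupSubspace_le σ d
  have h3 := W.blowupSubspace_projSubrep_le_spaceImage σ d U
  -- The enlarged subspace can be shrunk by at most `dim ker A`, and its image is no larger than
  -- that of `U`; hence its dimension is at most `dim U`.
  have h4 := finrank_le_finrank_spaceImage_add_ker hA
    (W.blowupSubspace (W.projSubrep (weightPos σ) d U).space (weightPos σ) d)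
  have h5 := Submodule.finrank_mono (h2.trans h3)
  exact ⟨Submodule.eq_of_le_of_finrank_le h1
      ((h4.trans (Nat.add_le_add_right h5 _)).trans hU),
    ((spaceImage_mono _ h1).trans h2).antisymm h3⟩

theorem wongSubrep_le_projSubrep [Fintype Q] (hB : IsPseudoInverse A B)
    (hA : A ∈ blowup (W.weightSpace σ) d) {U : Submodule F (W.BlowupCopies (weightPos σ) d)}
    (hU : finrank F (spaceImage (blowup (W.weightSpace σ) d) U) +
      finrank F (LinearMap.ker A) ≤ finrank F U) (x : Q) :
    (W.wongSubrep σ d A B).space x ≤ (W.projSubrep (weightPos σ) d U).space x := by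
  obtain ⟨h1, h2⟩ := eq_blowupSubspace_projSubrep hA hU
  obtain ⟨hker, hst⟩ := hB.stable_of_finrank_le hA hU
  refine wongSubrep_le _ (h1 ▸ hker) (fun z hz => ?_) x
  rw [← h1]
  exact hst z (h2 ▸ hz)

theorem blowupSubspace_wongSubrep_le [Fintype Q] (hB : IsPseudoInverse A B)
    (hA : A ∈ blowup (W.weightSpace σ) d) {U : Submodule F (W.BlowupCopies (weightPos σ) d)}
    (hU : finrank F (spaceImage (blowup (W.weightSpace σ) d) U) +
      finrank F (LinearMap.ker A) ≤ finrank F U) :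
    W.blowupSubspace (W.wongSubrep σ d A B).space (weightPos σ) d ≤ U :=
  (W.blowupSubspace_mono (wongSubrep_le_projSubrep hB hA hU) _ d).trans
    (eq_blowupSubspace_projSubrep hA hU).1.ge

/-- The sum of the copies of the spaces of `wongSubrep` is shrunk by `dim (ker A)`, and its image
is the sum of the copies of the same spaces. -/
theorem spaceImage_blowupSubspace_wongSubrep [Fintype Q] (hB : IsPseudoInverse A B)
    (hA : A ∈ blowup (W.weightSpace σ) d)
    (hmax : ∀ e : ℕ, 1 ≤ e → ∀ T ∈ blowup (blowup (W.weightSpace σ) d) e,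
      finrank F (LinearMap.range T) ≤ e * finrank F (LinearMap.range A)) :
    finrank F (W.blowupSubspace (W.wongSubrep σ d A B).space (weightPos σ) d) =
        finrank F (W.blowupSubspace (W.wongSubrep σ d A B).space (weightNeg σ) d) +
          finrank F (LinearMap.ker A) ∧
      spaceImage (blowup (W.weightSpace σ) d)
          (W.blowupSubspace (W.wongSubrep σ d A B).space (weightPos σ) d) =
        W.blowupSubspace (W.wongSubrep σ d A B).space (weightNeg σ) d := by
  obtain ⟨U, hker, hst, hmin⟩ := hB.exists_stable hA hmax
  have hU := hB.finrank_eq_of_stable hA hker hst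
  have hle := (W.wongSubrep σ d A B).spaceImage_blowupSubspace_le σ d
  -- Two minimality properties meet: `U` is least among stable subspaces containing `ker A`, and the
  -- copies of `W'` lie in every maximally shrunk subspace.
  have hUW : U = W.blowupSubspace (W.wongSubrep σ d A B).space (weightPos σ) d :=
    (hmin _ ker_le_blowupSubspace_wongSubrep fun T hT u hu =>
      apply_mem_blowupSubspace_wongSubrep (hle (map_le_spaceImage hT _ ⟨u, hu, rfl⟩))).antisymm
      (blowupSubspace_wongSubrep_le hB hA hU.ge)
  have himg : spaceImage (blowup (W.weightSpace σ) d) U =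
      W.blowupSubspace (W.wongSubrep σ d A B).space (weightNeg σ) d :=
    (hUW ▸ hle).antisymm ((W.blowupSubspace_mono
      (wongSubrep_le_projSubrep hB hA hU.ge) _ d).trans
      (eq_blowupSubspace_projSubrep hA hU.ge).2.ge)
  rw [himg] at hU
  rw [← hUW]
  exact ⟨hU, himg⟩

end Wong

end WeightSpace

end QuiverRep

/-! ### The main theorem -/

theorem mainTheorem5 {F : Type*} [Field F] {Q : Type*} [Quiver Q] [Fintype Q] [DecidableEq Q]
    (W : QuiverRep F Q) (σ : Q → ℤ) (d : ℕ) (hd : 1 ≤ d)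
    (A : W.BlowupCopies (weightPos σ) d →ₗ[F] W.BlowupCopies (weightNeg σ) d)
    (hA : A ∈ blowup (W.weightSpace σ) d)
    (hrank : (Module.finrank F (LinearMap.range A) : ℝ) = ncrk (blowup (W.weightSpace σ) d))
    (B : W.BlowupCopies (weightNeg σ) d →ₗ[F] W.BlowupCopies (weightPos σ) d)
    (hB : IsPseudoInverse A B) :
    -- `c` is the largest number for which the matrix space has a `c`-shrunk subspace,
    -- and `c d` is the largest one for its blow-up
    IsGreatest {k : ℝ | ∃ U, IsShrunk (W.weightSpace σ) k U}
        (shrinkNumber (W.weightSpace σ)) ∧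
    IsGreatest {k : ℝ | ∃ U, IsShrunk (blowup (W.weightSpace σ) d) k U}
        (shrinkNumber (W.weightSpace σ) * d) ∧
    -- `⨁ W'(x) ^ (d σ₊(x))` is `c d`-shrunk and contained in every `c d`-shrunk subspace
    IsLeast {U | IsShrunk (blowup (W.weightSpace σ) d) (shrinkNumber (W.weightSpace σ) * d) U}
        (W.blowupSubspace (W.wongSubrep σ d A B).space (weightPos σ) d) ∧
    -- its image under the blow-up is `⨁ W'(x) ^ (d σ₋(x))`
    spaceImage (blowup (W.weightSpace σ) d)
        (W.blowupSubspace (W.wongSubrep σ d A B).space (weightPos σ) d) =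
      W.blowupSubspace (W.wongSubrep σ d A B).space (weightNeg σ) d ∧
    -- `W'` is an optimal `σ`-witness, of weight `c`
    (W.wongSubrep σ d A B).IsOptimalWitness σ ∧
    (((W.wongSubrep σ d A B).weight σ : ℤ) : ℝ) = shrinkNumber (W.weightSpace σ) := by
  -- Since `rk A` equals the non-commutative rank of the `d`-th blow-up, no further blow-up can
  -- exceed it proportionally.
  have hmax : ∀ e : ℕ, 1 ≤ e → ∀ T ∈ blowup (blowup (W.weightSpace σ) d) e,
      Module.finrank F (LinearMap.range T) ≤ e * Module.finrank F (LinearMap.range A) := by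
    intro e he T hT
    have h := finrank_range_le_mul_ncrk he hT
    rw [← hrank] at h
    exact_mod_cast h
  obtain ⟨hdim, himg⟩ := QuiverRep.spaceImage_blowupSubspace_wongSubrep hB hA hmax
  set S := W.wongSubrep σ d A B with hS
  have hd0 : (0 : ℝ) < d := by exact_mod_cast hd
  have hweight : (S.weight σ : ℝ) * d = Module.finrank F (LinearMap.ker A) := by
    rw [QuiverRep.finrank_blowupSubspace, QuiverRep.finrank_blowupSubspace] at hdim
    rw [S.weight_eq]
    have h : (d : ℝ) * Module.finrank F (W.copiesSubspace S.space (weightPos σ)) =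
        d * Module.finrank F (W.copiesSubspace S.space (weightNeg σ)) +
          Module.finrank F (LinearMap.ker A) := by
      exact_mod_cast hdim
    push_cast
    linarith
  -- Upper bound: the copies of `W'` are shrunk by the weight. Lower bound: `rk A ≤ d * ncrk` for
  -- the original space, so `dim ker A ≥ c d`.
  have hc : (S.weight σ : ℝ) = shrinkNumber (W.weightSpace σ) := by
    have h1 := (S.isShrunk σ).ncrk_le
    have h2 := finrank_range_le_mul_ncrk hd hA
    have h3 : (Module.finrank F (LinearMap.range A) : ℝ) +
        Module.finrank F (LinearMap.ker A) =
        d * Module.finrank F (W.Copies (weightPos σ)) := by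
      have := A.finrank_range_add_finrank_ker
      rw [Module.finrank_pi_fintype, Finset.sum_const, Finset.card_univ, Fintype.card_fin,
        smul_eq_mul] at this
      exact_mod_cast this
    rw [shrinkNumber]
    refine le_antisymm (by linarith) (le_of_mul_le_mul_right ?_ hd0)
    linarith
  rw [← hc, hweight]
  -- This one bound gives both the maximality of `c` and, applied to the copies of a
  -- subrepresentation, the optimality of `W'`.
  have hle : ∀ {k : ℝ} {U}, IsShrunk (W.weightSpace σ) k U → k ≤ S.weight σ := by
    intro k U hU
    have h := (hU.pi d).le_finrank_ker hA
    rw [← hweight] at h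
    exact le_of_mul_le_mul_right h hd0
  have hshrunk : IsShrunk (blowup (W.weightSpace σ) d) (Module.finrank F (LinearMap.ker A))
      (W.blowupSubspace S.space (weightPos σ) d) := by
    rw [isShrunk_iff, himg, hdim]
    push_cast
    linarith
  refine ⟨⟨⟨_, S.isShrunk σ⟩, fun k ⟨U, hU⟩ => hle hU⟩,
    ⟨⟨_, hshrunk⟩, fun k ⟨U, hU⟩ => hU.le_finrank_ker hA⟩,
    ⟨hshrunk, fun U hU => QuiverRep.blowupSubspace_wongSubrep_le hB hA ?_⟩, himg,
    fun S' => by exact_mod_cast hle (S'.isShrunk σ), rfl⟩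
  have h : (Module.finrank F (spaceImage (blowup (W.weightSpace σ) d) U) : ℝ) +
      Module.finrank F (LinearMap.ker A) ≤ Module.finrank F U := by
    have := (isShrunk_iff _ _ _).1 hU
    linarith
  exact_mod_cast h
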